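/- **Setting.** Nodes and addresses are natural numbers, with $\mathrm{null}=0$. A *binary graph* over a set $T$ is a finite partial map $\gamma$, undefined at $\mathrm{null}$, sending a node $x$ to a triple $\gamma\,x=(v,[l,r])$: its contents $v=\gamma_{\mathrm{val}}\,x\in T$ and its left and right children $l=\gamma_l\,x$, $r=\gamma_r\,x$, which may be $\mathrm{null}$ and need not be nodes of $\gamma$. Write $\mathrm{nodes}\,\gamma$ for its domain, $\mathrm{nodes}_0\,\gamma=\{\mathrm{null}\}\cup\mathrm{nodes}\,\gamma$, $\gamma\setminus x$ for $\gamma$ made undefined at $x$, $\gamma/_{V}$ for the restriction of $\gamma$ to the nodes with contents in $V$, and $\lfloor\gamma\rfloor$ (erasure) for $\gamma$ with the contents forgotten. $\gamma$ is *closed* if all children of its nodes lie in $\mathrm{nodes}_0\,\gamma$. Recursively, $\mathrm{reach}\,\gamma\,x=\{x\}\cup\mathrm{reach}\,(\gamma\setminus x)\,(\gamma_l\,x)\cup\mathrm{reach}\,(\gamma\setminus x)\,(\gamma_r\,x)$ if $x\in\mathrm{nodes}\,\gamma$, and $\mathrm{reach}\,\gamma\,x=\emptyset$ otherwise. Graphs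 below have contents (marks) in $\{O,L,R,X\}$. A heap is a finite partial map from non-null addresses to values (pointers, marks, booleans). $\mathrm{graph}\,\gamma$ holds of a heap that is the disjoint union, over $x\in\mathrm{nodes}\,\gamma$ with $\gamma\,x=(m,[l,r])$, of heaps consisting of exactly the three cells $x,x+1,x+2$ storing $m,l,r$; these cells are denoted $x.m$, $x.l$, $x.r$. **Algorithm.** Let TM be `if t = null then tm := true else tmp := *t.m; tm := (tmp ≠ O)`, and let - PUSH be `tmp := *t.l; t.l := p; t.m := L; p := t; t := tmp`, - SWING be `tmp1 := *p.r; tmp2 := *p.l; p.r := tmp2; p.l := t; p.m := R; t := tmp1`, - POP be `tmp := *p.r; p.r := t; p.m := X; t := p; p := tmp`. Schorr-Waite$(r)$ is INIT followed by `while p ≠ null ∨ ¬tm do` BODY, where INIT is `t := r; p := null;` TM, and BODY is `if tm then (pm := *p.m; if pm = R then` POP `else` SWING`) else` PUSH`;` TM. A triple $\{P\}\,c\,\{Q\}$ means total correctness: from each state satisfying $P$, the command $c$ causes no memory fault and terminates, and only in states satisfying $Q$. **Invariant.** Let $\mathrm{inv}\,\gamma_0\,\gamma\,t\,p$ mean that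 there is a sequence of nodes $\alpha$ such that (a) the elements of $\alpha$ are distinct and non-null, $p$ is the last element of $\mathrm{null}\cdot\alpha$, and $t\in\mathrm{nodes}_0\,\gamma$; (b) $\gamma$ is closed; (c) $\mathrm{nodes}\,(\gamma/_{L,R})$ is the set of elements of $\alpha$; (d) replacing, for each node $x$ of $\gamma$ marked $L$ (resp. $R$), its left (resp. right) child by the predecessor of $x$ in $\mathrm{null}\cdot\alpha$, and erasing marks, gives $\lfloor\gamma\rfloor$; (e) replacing, for each node $x$ of $\gamma$ marked $L$ (resp. $R$), its left (resp. right) child by the successor of the first occurrence of $x$ in $\alpha\cdot t$, and erasing marks, gives $\lfloor\gamma_0\rfloor$; (f) $\mathrm{nodes}\,(\gamma/_O)\subseteq\bigcup_{y\in\alpha}\mathrm{reach}\,(\gamma/_O)\,(\gamma_r\,y)\,\cup\,\mathrm{reach}\,(\gamma/_O)\,t$. Let $\mathrm{marked}_0\,\gamma=\mathrm{nodes}_0\,(\gamma/_{L,R,X})$, and let $I$ be the assertion $\exists\gamma.\ \mathrm{graph}\,\gamma\wedge\mathrm{inv}\,\gamma_0\,\gamma\,t\,p\wedge \mathit{tm}=(t\in\mathrm{marked}_0\,\gamma)$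 about the program variables $t,p,\mathit{tm}$ and the heap. **Theorem.** For every binary graph $\gamma_0$ with marks and every node $r$, with $$P_0\;:=\;\mathrm{graph}\,\gamma_0\wedge\gamma_0\text{ closed}\wedge r\in\mathrm{nodes}\,\gamma_0\wedge\mathrm{nodes}\,\gamma_0=\mathrm{reach}\,(\gamma_0/_O)\,r$$ (in particular $\gamma_0$ is unmarked), the following hold. 1. $\{P_0\}$ Schorr-Waite$(r)$ $\{\exists\gamma.\ \mathrm{graph}\,\gamma\wedge\lfloor\gamma_0\rfloor=\lfloor\gamma\rfloor\wedge\gamma=\gamma/_X\}$. 2. $I$ is an invariant of the loop: $\{P_0\}$ INIT $\{I\}$ and $\{I\wedge(p\ne\mathrm{null}\vee\neg \mathit{tm})\}$ BODY $\{I\}$. 3. PUSH, SWING and POP preserve the invariant: with $Q:=\exists\gamma.\ \mathrm{graph}\,\gamma\wedge\mathrm{inv}\,\gamma_0\,\gamma\,t\,p$, - $\{\exists\gamma.\ \mathrm{graph}\,\gamma\wedge\mathrm{inv}\,\gamma_0\,\gamma\,t\,p\wedge t\notin\mathrm{marked}_0\,\gamma\}$ PUSH $\{Q\}$, - $\{\exists\gamma.\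 \mathrm{graph}\,\gamma\wedge\mathrm{inv}\,\gamma_0\,\gamma\,t\,p\wedge t\in\mathrm{marked}_0\,\gamma\wedge\gamma_{\mathrm{val}}\,p=L\}$ SWING $\{Q\}$, - $\{\exists\gamma.\ \mathrm{graph}\,\gamma\wedge\mathrm{inv}\,\gamma_0\,\gamma\,t\,p\wedge t\in\mathrm{marked}_0\,\gamma\wedge\gamma_{\mathrm{val}}\,p=R\}$ POP $\{Q\}$. -/

import Mathlib

namespace SchorrWaite

/-! ### Finite partial maps on nodes / addresses, undefined on null -/

/-- Finite partial maps from pointers (natural numbers) to `β` that are undefined on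
`null = 0`. Both heaps and binary graphs are such maps. -/
@[ext]
structure PMap (β : Type) where
  toFun : ℕ → Option β
  finite_dom : {x | toFun x ≠ none}.Finite
  null_undef : toFun 0 = none

instance {β : Type} : CoeFun (PMap β) (fun _ => ℕ → Option β) := ⟨PMap.toFun⟩

/-- The null pointer. -/
abbrev null : ℕ := 0

namespace PMap

variable {β : Type}

/-- The domain of a map. -/
def dom (f : PMap β) : Set ℕ := {x | f x ≠ none}

theorem dom_finite (f : PMap β) : f.dom.Finite := f.finite_dom

theorem ne_null_of_ne_none (f : PMap β) {x : ℕ} (hx : f x ≠ none) : x ≠ 0 := by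
  rintro rfl
  exact hx f.null_undef

open Classical in
/-- Restriction of a map to a set of pointers. -/
noncomputable def restrict (f : PMap β) (S : Set ℕ) : PMap β where
  toFun x := if x ∈ S then f x else none
  finite_dom := f.finite_dom.subset (by
    intro x hx
    simp only [Set.mem_ofPred_eq] at hx ⊢
    intro h
    exact hx (by simp [h]))
  null_undef := by simp [f.null_undef]

/-- The map made undefined on `x`, unchanged elsewhere. -/
def erase (f : PMap β) (x : ℕ) : PMap β where
  toFun y := if y = x then none else f y
  finite_dom := f.finite_dom.subset (by
    intro y hy
    simp only [Set.mem_ofPred_eq] at hy ⊢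
    intro h
    exact hy (by simp [h]))
  null_undef := by simp [f.null_undef]

/-- Overwriting the value at a pointer `x` that is in the domain. -/
def update (f : PMap β) (x : ℕ) (v : β) (hx : f x ≠ none) : PMap β where
  toFun y := if y = x then some v else f y
  finite_dom := f.finite_dom.subset (by
    intro y hy
    simp only [Set.mem_ofPred_eq] at hy ⊢
    by_cases h : y = x
    · rw [h]; exact hx
    · simpa [h] using hy)
  null_undef := by
    have := f.ne_null_of_ne_none hx
    simp [this.symm, f.null_undef]

/-- `h` is the disjoint union of `h₁` and `h₂` (which must have disjoint domains). -/
def IsDisjUnion (h₁ h₂ h : PMap β) : Prop :=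
  (∀ x, h₁ x = none ∨ h₂ x = none) ∧ ∀ x, h x = (h₁ x).or (h₂ x)

end PMap

/-! ### Binary partial graphs -/

/-- Binary partial graphs with node contents in `T`: each node of the finite domain is mapped
to its contents, its left child and its right child (`null` if there is no such child).
Children need not be nodes of the graph. -/
abbrev BinaryGraph (T : Type) := PMap (T × ℕ × ℕ)

namespace BinaryGraph

variable {T : Type}

/-- The set of nodes of a graph. -/
def nodes (γ : BinaryGraph T) : Set ℕ := PMap.dom γ

/-- The nodes of a graph together with `null`. -/
def nodes₀ (γ : BinaryGraph T) : Set ℕ := {null} ∪ γ.nodes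

/-- The contents of a node (`none` outside the graph). -/
def val (γ : BinaryGraph T) (x : ℕ) : Option T := (γ x).map fun c => c.1

/-- The set of children of a node (empty outside the graph). -/
def adj (γ : BinaryGraph T) (x : ℕ) : Set ℕ := {y | ∃ v l r, γ x = some (v, l, r) ∧ (y = l ∨ y = r)}

/-- The left child of a node (`null` outside the graph). -/
def left (γ : BinaryGraph T) (x : ℕ) : ℕ := ((γ x).map fun c => c.2.1).getD null

/-- The right child of a node (`null` outside the graph). -/
def right (γ : BinaryGraph T) (x : ℕ) : ℕ := ((γ x).map fun c => c.2.2).getD null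

/-- The nodes with an incoming edge. -/
def sinks (γ : BinaryGraph T) : Set ℕ := ⋃ x ∈ γ.nodes, γ.adj x

/-- A graph is closed if it has no dangling edges. -/
def Closed (γ : BinaryGraph T) : Prop := γ.sinks ⊆ γ.nodes₀

/-- Filtering by contents: the subgraph of the nodes with contents in `V`. -/
noncomputable def filter (γ : BinaryGraph T) (V : Set T) : BinaryGraph T :=
  PMap.restrict γ {x | ∃ v ∈ V, γ.val x = some v}

/-- Replace contents and children of every node `x` by `f x` applied to them. -/
def map {T' : Type} (f : ℕ → T × ℕ × ℕ → T' × ℕ × ℕ) (γ : BinaryGraph T) : BinaryGraph T' where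
  toFun x := (γ x).map (f x)
  finite_dom := γ.finite_dom.subset (by
    intro x hx
    simpa using hx)
  null_undef := by simp [γ.null_undef]

/-- Erasure of a graph: forget the contents of the nodes. -/
def erasure (γ : BinaryGraph T) : BinaryGraph Unit := map (fun _ c => ((), c.2)) γ

theorem ncard_nodes_erase_lt (γ : BinaryGraph T) {x : ℕ} (hx : x ∈ γ.nodes) :
    (nodes (PMap.erase γ x)).ncard < γ.nodes.ncard := by
  refine Set.ncard_lt_ncard ⟨?_, ?_⟩ (PMap.dom_finite γ)
  · intro y hy
    simp only [nodes, PMap.dom, PMap.erase, Set.mem_ofPred_eq] at hy ⊢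
    intro h
    exact hy (by simp [h])
  · intro h
    have := h hx
    simp [nodes, PMap.dom, PMap.erase] at this

open Classical in
/-- The set of nodes of `γ` reachable from `x`: `x` itself and the nodes reachable from the
children of `x` by paths that avoid `x`. -/
noncomputable def reach (γ : BinaryGraph T) (x : ℕ) : Set ℕ :=
  if _hx : x ∈ γ.nodes then
    {x} ∪ (reach (PMap.erase γ x) (γ.left x) ∪ reach (PMap.erase γ x) (γ.right x))
  else ∅
termination_by γ.nodes.ncard
decreasing_by
  all_goals exact ncard_nodes_erase_lt γ _hx

end BinaryGraph

/-! ### Marks, values, heaps, and the heap layout of a graph -/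

/-- Marks: unmarked, traversed once to the left, left subgraph done, both subgraphs done. -/
inductive Mark where
  | O | L | R | X
  deriving DecidableEq

/-- Values stored in program variables and in the heap. -/
inductive Val where
  | ptr (x : ℕ)
  | mark (m : Mark)
  | bool (b : Bool)
  deriving DecidableEq

/-- Heaps: finite partial maps from non-null addresses to values. -/
abbrev Heap := PMap Val

/-- The heap consisting of exactly the three cells `x`, `x+1`, `x+2`, which store the mark `m`
and the pointers `l` and `r`. -/
def PointsTo (x : ℕ) (m : Mark) (l r : ℕ) (h : Heap) : Prop :=
  ∀ a, h a = if a = x then some (.mark m) else if a = x + 1 then some (.ptr l)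
    else if a = x + 2 then some (.ptr r) else none

/-- The spatial predicate `graph γ`: it holds of the empty heap for the empty graph, and of a
heap that splits into the three cells of a node `x` of `γ` and a disjoint heap satisfying
`graph (γ \ x)`. -/
inductive IsGraph : BinaryGraph Mark → Heap → Prop where
  | empty {γ : BinaryGraph Mark} {h : Heap} (hγ : ∀ x, γ x = none) (hh : ∀ a, h a = none) :
      IsGraph γ h
  | node {γ : BinaryGraph Mark} {h h₁ h₂ : Heap} {x : ℕ} {m : Mark} {l r : ℕ}
      (hx : γ x = some (m, l, r)) (h_cells : PointsTo x m l r h₁)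
      (h_rest : IsGraph (PMap.erase γ x) h₂) (h_union : PMap.IsDisjUnion h₁ h₂ h) :
      IsGraph γ h

/-! ### The programming language -/

/-- Program variables. -/
inductive Var where
  | t | p | tm | pm | tmp | tmp₁ | tmp₂
  deriving DecidableEq

/-- Variable stores. -/
abbrev Store := Var → Val

/-- Pure expressions. -/
inductive Expr where
  | const (v : Val)
  | var (x : Var)
  | eq (e₁ e₂ : Expr)
  | not (e : Expr)
  | or (e₁ e₂ : Expr)

/-- Value of an expression. -/
def Expr.eval (s : Store) : Expr → Val
  | .const v => v
  | .var x => s x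
  | .eq e₁ e₂ => .bool (decide (e₁.eval s = e₂.eval s))
  | .not e => .bool (decide (e.eval s ≠ .bool true))
  | .or e₁ e₂ => .bool (decide (e₁.eval s = .bool true ∨ e₂.eval s = .bool true))

/-- The fields of a node: mark, left child, right child. -/
inductive Field where
  | m | l | r

/-- Offset of a field from the address of the node. -/
def Field.offset : Field → ℕ
  | .m => 0
  | .l => 1
  | .r => 2

/-- Commands. `load x y f` is `x := *(y.f)`, and `store y f e` is `y.f := e`. -/
inductive Cmd where
  | assign (x : Var) (e : Expr)
  | load (x : Var) (y : Var) (f : Field)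
  | store (y : Var) (f : Field) (e : Expr)
  | seq (c₁ c₂ : Cmd)
  | ite (e : Expr) (c₁ c₂ : Cmd)
  | while (e : Expr) (c : Cmd)

/-- Program states: a variable store and a heap. -/
structure State where
  store : Store
  heap : Heap

/-- The address of `y.f` if `y` holds a pointer. -/
def address (s : Store) (y : Var) (f : Field) : Option ℕ :=
  match s y with
  | .ptr x => some (x + f.offset)
  | _ => none

/-- Results of terminating executions: a memory fault, or a final state. -/
inductive Outcome where
  | fault
  | ok (σ : State)

/-- Big-step operational semantics: `Exec c σ o` says that running `c` from `σ` terminates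
with outcome `o`. Access to memory through a non-pointer or at an unallocated address faults. -/
inductive Exec : Cmd → State → Outcome → Prop where
  | assign (x : Var) (e : Expr) (σ : State) :
      Exec (.assign x e) σ (.ok ⟨Function.update σ.store x (e.eval σ.store), σ.heap⟩)
  | load (x y : Var) (f : Field) (σ : State) (a : ℕ) (v : Val)
      (ha : address σ.store y f = some a) (hv : σ.heap a = some v) :
      Exec (.load x y f) σ (.ok ⟨Function.update σ.store x v, σ.heap⟩)
  | load_fault (x y : Var) (f : Field) (σ : State)
      (hf : ∀ a, address σ.store y f = some a → σ.heap a = none) :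
      Exec (.load x y f) σ .fault
  | store (y : Var) (f : Field) (e : Expr) (σ : State) (a : ℕ)
      (ha : address σ.store y f = some a) (hv : σ.heap a ≠ none) :
      Exec (.store y f e) σ (.ok ⟨σ.store, PMap.update σ.heap a (e.eval σ.store) hv⟩)
  | store_fault (y : Var) (f : Field) (e : Expr) (σ : State)
      (hf : ∀ a, address σ.store y f = some a → σ.heap a = none) :
      Exec (.store y f e) σ .fault
  | seq (c₁ c₂ : Cmd) (σ σ' : State) (o : Outcome)
      (h₁ : Exec c₁ σ (.ok σ')) (h₂ : Exec c₂ σ' o) : Exec (.seq c₁ c₂) σ o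
  | seq_fault (c₁ c₂ : Cmd) (σ : State) (h₁ : Exec c₁ σ .fault) : Exec (.seq c₁ c₂) σ .fault
  | ite_true (e : Expr) (c₁ c₂ : Cmd) (σ : State) (o : Outcome)
      (he : e.eval σ.store = .bool true) (h : Exec c₁ σ o) : Exec (.ite e c₁ c₂) σ o
  | ite_false (e : Expr) (c₁ c₂ : Cmd) (σ : State) (o : Outcome)
      (he : e.eval σ.store ≠ .bool true) (h : Exec c₂ σ o) : Exec (.ite e c₁ c₂) σ o
  | while_false (e : Expr) (c : Cmd) (σ : State)
      (he : e.eval σ.store ≠ .bool true) : Exec (.while e c) σ (.ok σ)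
  | while_true (e : Expr) (c : Cmd) (σ σ' : State) (o : Outcome)
      (he : e.eval σ.store = .bool true) (h₁ : Exec c σ (.ok σ'))
      (h₂ : Exec (.while e c) σ' o) : Exec (.while e c) σ o
  | while_fault (e : Expr) (c : Cmd) (σ : State)
      (he : e.eval σ.store = .bool true) (h₁ : Exec c σ .fault) : Exec (.while e c) σ .fault

/-- Assertions about program states. -/
abbrev Assertion := State → Prop

/-- Fault-avoiding total correctness: from every state that satisfies `P`, the command `c`
does not fault, terminates, and can only terminate in states that satisfy `Q`. -/
def Triple (P : Assertion) (c : Cmd) (Q : Assertion) : Prop :=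
  ∀ σ, P σ → ¬ Exec c σ .fault ∧ (∃ σ', Exec c σ (.ok σ')) ∧ ∀ σ', Exec c σ (.ok σ') → Q σ'

/-! ### The Schorr-Waite algorithm -/

/-- `if t = null then tm := true else tmp := *t.m; tm := (tmp ≠ O) end if` -/
def readMark : Cmd :=
  .ite (.eq (.var .t) (.const (.ptr null)))
    (.assign .tm (.const (.bool true)))
    (.seq (.load .tmp .t .m)
      (.assign .tm (.not (.eq (.var .tmp) (.const (.mark .O))))))

/-- `tmp := *t.l; t.l := p; t.m := L; p := t; t := tmp` -/
def push : Cmd :=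
  .seq (.load .tmp .t .l) <|
  .seq (.store .t .l (.var .p)) <|
  .seq (.store .t .m (.const (.mark .L))) <|
  .seq (.assign .p (.var .t))
    (.assign .t (.var .tmp))

/-- `tmp₁ := *p.r; tmp₂ := *p.l; p.r := tmp₂; p.l := t; p.m := R; t := tmp₁` -/
def swing : Cmd :=
  .seq (.load .tmp₁ .p .r) <|
  .seq (.load .tmp₂ .p .l) <|
  .seq (.store .p .r (.var .tmp₂)) <|
  .seq (.store .p .l (.var .t)) <|
  .seq (.store .p .m (.const (.mark .R)))
    (.assign .t (.var .tmp₁))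

/-- `tmp := *p.r; p.r := t; p.m := X; t := p; p := tmp` -/
def pop : Cmd :=
  .seq (.load .tmp .p .r) <|
  .seq (.store .p .r (.var .t)) <|
  .seq (.store .p .m (.const (.mark .X))) <|
  .seq (.assign .t (.var .p))
    (.assign .p (.var .tmp))

/-- `t := r; p := null`, followed by the computation of `tm`. -/
def setup (r : ℕ) : Cmd :=
  .seq (.assign .t (.const (.ptr r))) <|
  .seq (.assign .p (.const (.ptr null)))
    readMark

/-- The loop condition `p ≠ null ∨ ¬ tm`. -/
def loopCond : Expr :=
  .or (.not (.eq (.var .p) (.const (.ptr null)))) (.not (.var .tm))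

/-- The loop body: `if tm then pm := *p.m; if pm = R then POP else SWING end if
else PUSH end if`, followed by the computation of `tm`. -/
def loopBody : Cmd :=
  .seq
    (.ite (.var .tm)
      (.seq (.load .pm .p .m)
        (.ite (.eq (.var .pm) (.const (.mark .R))) pop swing))
      push)
    readMark

/-- The algorithm `Schorr-Waite(r)`. -/
def schorrWaite (r : ℕ) : Cmd :=
  .seq (setup r) (.while loopCond loopBody)

/-! ### The invariants -/

open BinaryGraph

/-- `prev (null · α) x`: the predecessor in `null · α` of the first occurrence of `x` in `α`,
or `null` if `x ∉ α`. -/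
def prev (α : List ℕ) (x : ℕ) : ℕ :=
  if x ∈ α then (null :: α).getD (α.idxOf x) null else null

/-- `next (α · t) x`: the successor in `α · t` of the first occurrence of `x` in `α`,
or `t` if `x ∉ α`. -/
def next (α : List ℕ) (t : ℕ) (x : ℕ) : ℕ :=
  if x ∈ α then (α ++ [t]).getD (α.idxOf x + 1) t else t

/-- Replace the left child of `x` by `f x` if the mark is `L`, the right child if it is `R`,
and drop the mark. -/
def ifMark (f : ℕ → ℕ) (x : ℕ) : Mark × ℕ × ℕ → Unit × ℕ × ℕ
  | (.L, _, r) => ((), f x, r)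
  | (.R, l, _) => ((), l, f x)
  | (.O, l, r) => ((), l, r)
  | (.X, l, r) => ((), l, r)

/-- `inset α γ`. -/
def inset (α : List ℕ) (γ : BinaryGraph Mark) : BinaryGraph Unit :=
  BinaryGraph.map (ifMark (prev α)) γ

/-- `restore t α γ`. -/
def restore (t : ℕ) (α : List ℕ) (γ : BinaryGraph Mark) : BinaryGraph Unit :=
  BinaryGraph.map (ifMark (next α t)) γ

/-- The invariant relating the initial graph `γ₀`, the current graph `γ`, the stack `α`, the
tip `t` and the predecessor `p`. -/
structure Inv' (γ₀ γ : BinaryGraph Mark) (α : List ℕ) (t p : ℕ) : Prop where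
  uniq : (null :: α).Nodup
  p_eq : p = (null :: α).getLast (List.cons_ne_nil _ _)
  t_mem : t ∈ γ.nodes₀
  closed : γ.Closed
  stack : (γ.filter {.L, .R}).nodes = {x | x ∈ α}
  inset_eq : inset α γ = γ.erasure
  restore_eq : restore t α γ = γ₀.erasure
  unmarked : (γ.filter {.O}).nodes ⊆
    (⋃ y ∈ {y | y ∈ α}, reach (γ.filter {.O}) (γ.right y)) ∪ reach (γ.filter {.O}) t

/-- The invariant with the stack quantified existentially. -/
def Inv (γ₀ γ : BinaryGraph Mark) (t p : ℕ) : Prop := ∃ α, Inv' γ₀ γ α t p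

/-- The marked nodes of `γ`, including `null`. -/
def marked₀ (γ : BinaryGraph Mark) : Set ℕ := (γ.filter {.L, .R, .X}).nodes₀

/-! ### The assertions -/

/-- The heap is laid out as a graph `γ` which, together with the values of the program
variables `t` and `p`, satisfies the invariant and the further condition `C γ t p`. -/
def InvWith (γ₀ : BinaryGraph Mark) (C : BinaryGraph Mark → ℕ → ℕ → Prop) : Assertion :=
  fun σ => ∃ (γ : BinaryGraph Mark) (t p : ℕ),
    σ.store .t = .ptr t ∧ σ.store .p = .ptr p ∧ IsGraph γ σ.heap ∧ Inv γ₀ γ t p ∧ C γ t p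

/-- The loop invariant: additionally, the variable `tm` tells whether `t` is marked or null. -/
def LoopInv (γ₀ : BinaryGraph Mark) : Assertion :=
  fun σ => InvWith γ₀
    (fun γ t _ => ∃ b : Bool, σ.store .tm = .bool b ∧ (b = true ↔ t ∈ marked₀ γ)) σ

/-- Precondition: the heap is laid out as `γ₀`, which is closed, contains `r`, and all of whose
nodes are reachable from `r` by unmarked paths. -/
def Pre (γ₀ : BinaryGraph Mark) (r : ℕ) : Assertion :=
  fun σ => IsGraph γ₀ σ.heap ∧ γ₀.Closed ∧ r ∈ γ₀.nodes ∧
    γ₀.nodes = reach (γ₀.filter {.O}) r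

/-- Postcondition: the heap is laid out as a graph with the same erasure as `γ₀` and with all
nodes marked `X`. -/
def Post (γ₀ : BinaryGraph Mark) : Assertion :=
  fun σ => ∃ γ : BinaryGraph Mark,
    IsGraph γ σ.heap ∧ γ₀.erasure = γ.erasure ∧ γ = γ.filter {.X}

end SchorrWaite

open SchorrWaite

namespace SchorrWaite

open BinaryGraph

/-! ### Partial maps -/

namespace PMap

variable {β : Type}

/-! The stack `α` is stored in the graph itself: a node marked `L` (resp. `R`) keeps its stack
predecessor in its left (resp. right) field, and the child displaced from there is the next stack
node or, at the top of the stack, the tip `t`. So `inset_eq` says that the reversed pointers spell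
out the stack, and `restore_eq` that undoing the reversal gives back the initial graph.

PUSH, SWING and POP each overwrite one node, which is the top of the stack before or after the step.
At that node the restored triple is unchanged by direct computation; at the other stack nodes it is
unchanged because their neighbours in the stack do not move (`restore_update`,
`next_append_of_mem`). The delicate clause is `unmarked`. `mem_reach` turns the recursive `reach`
into existence of paths. PUSH deletes `t` from the unmarked subgraph, and a path through `t` is cut
at its last visit there (`Connected.erase`). SWING and POP leave the unmarked subgraph alone, and a
marked tip starts no path in it. This gives `Inv'.push`, `Inv'.swing` and `Inv'.pop`.

On exit the stack is empty and the tip is marked or null, which rules out `L`, `R` and `O`; all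
nodes are `X`, where restoring does nothing (`Inv'.final`). Every iteration moves one mark forward
along `O`, `L`, `R`, `X`, so `visits` decreases. Execution is deterministic, so total correctness
needs only one good run (`triple_iff_wp`), and `IsGraph.update` carries changes of cells over to
changes of graph nodes. -/

theorem coe_injective {f g : PMap β} (h : ∀ x, f x = g x) : f = g :=
  PMap.ext (funext h)

theorem erase_apply (f : PMap β) (x y : ℕ) : erase f x y = if y = x then none else f y := rfl

theorem update_apply (f : PMap β) (x : ℕ) (v : β) (hx : f x ≠ none) (y : ℕ) :
    update f x v hx y = if y = x then some v else f y := rfl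

open Classical in
theorem restrict_apply (f : PMap β) (S : Set ℕ) (x : ℕ) :
    restrict f S x = if x ∈ S then f x else none := rfl

theorem erase_comm (f : PMap β) (x y : ℕ) : erase (erase f x) y = erase (erase f y) x := by
  apply coe_injective
  intro z
  simp only [erase_apply]
  split_ifs <;> rfl

theorem erase_update (f : PMap β) (x : ℕ) (v : β) (hx : f x ≠ none) :
    erase (update f x v hx) x = erase f x := by
  apply coe_injective
  intro z
  simp only [erase_apply, update_apply]
  split_ifs <;> rfl

end PMap

/-! ### Heaps laid out as graphs -/

/-- A derivation of `IsGraph` peels off nodes in some fixed order. Since disjoint union is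
commutative and associative, any node can be moved to the front. -/
theorem IsGraph.exists_split {γ : BinaryGraph Mark} {h : Heap} (hg : IsGraph γ h) {x : ℕ}
    {m : Mark} {l r : ℕ} (hx : γ x = some (m, l, r)) :
    ∃ h₁ h₂, PointsTo x m l r h₁ ∧ IsGraph (PMap.erase γ x) h₂ ∧ PMap.IsDisjUnion h₁ h₂ h := by
  induction hg with
  | empty hγ _ => simp [hγ] at hx
  | @node γ h h₁ h₂ x₀ m₀ l₀ r₀ hx₀ hc hr hu ih =>
    by_cases hxx : x = x₀
    · subst hxx
      rw [hx₀] at hx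
      cases hx
      exact ⟨h₁, h₂, hc, hr, hu⟩
    · obtain ⟨k₁, k₂, kc, kr, ku⟩ := ih (by rw [PMap.erase_apply, if_neg hxx, hx])
      -- The remaining heap is the union of `h₁` and `k₂`; as a restriction of `h` it is finite for
      -- free.
      refine ⟨k₁, PMap.restrict h {a | k₁ a = none}, kc,
        IsGraph.node (x := x₀) (m := m₀) (l := l₀) (r := r₀) (h₁ := h₁) (h₂ := k₂) ?_ hc ?_ ?_, ?_⟩
      · rw [PMap.erase_apply, if_neg (Ne.symm hxx), hx₀]
      · rw [PMap.erase_comm]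
        exact kr
      · constructor
        · intro a
          have h1 := hu.1 a
          have h2 := ku.2 a
          rcases h1 with h1 | h1
          · exact Or.inl h1
          · rw [h1] at h2
            exact Or.inr (Option.or_eq_none_iff.1 h2.symm).2
        · intro a
          have h1 := hu.1 a
          have h2 := ku.2 a
          have h3 := hu.2 a
          have h4 := ku.1 a
          simp only [PMap.restrict_apply, Set.mem_ofPred_eq]
          split_ifs with h5
          · rw [h3, h2, h5, Option.none_or]
          · rw [Or.resolve_left h4 h5] at h2 ⊢
            rw [Option.or_none] at h2
            rw [h2] at h1
            simp [Or.resolve_right h1 h5]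
      · constructor
        · intro a
          simp only [PMap.restrict_apply, Set.mem_ofPred_eq]
          split_ifs with h5
          · exact Or.inl h5
          · exact Or.inr rfl
        · intro a
          have h1 := hu.1 a
          have h2 := ku.2 a
          have h3 := hu.2 a
          have h4 := ku.1 a
          simp only [PMap.restrict_apply, Set.mem_ofPred_eq]
          split_ifs with h5
          · rw [h5, Option.none_or]
          · rw [Or.resolve_left h4 h5, Option.or_none] at h2
            rw [h2] at h1 h3
            rw [h3, Or.resolve_right h1 h5]
            simp

theorem IsGraph.cells {γ : BinaryGraph Mark} {h : Heap} (hg : IsGraph γ h) {x : ℕ}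
    {m : Mark} {l r : ℕ} (hx : γ x = some (m, l, r)) :
    h x = some (.mark m) ∧ h (x + 1) = some (.ptr l) ∧ h (x + 2) = some (.ptr r) := by
  obtain ⟨h₁, h₂, hc, -, hu⟩ := hg.exists_split hx
  refine ⟨?_, ?_, ?_⟩ <;> rw [hu.2, hc] <;> simp

/-- Overwriting the three cells of a node changes the graph at that node only. -/
theorem IsGraph.update {γ : BinaryGraph Mark} {h : Heap} (hg : IsGraph γ h) {x : ℕ}
    (hx : γ x ≠ none) (m : Mark) (l r : ℕ)
    (h' : Heap) (hh : ∀ a, h' a = if a = x then some (.mark m) else if a = x + 1 then some (.ptr l)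
      else if a = x + 2 then some (.ptr r) else h a) :
    IsGraph (PMap.update γ x (m, l, r) hx) h' := by
  obtain ⟨⟨m₀, l₀, r₀⟩, hx₀⟩ := Option.ne_none_iff_exists'.1 hx
  obtain ⟨h₁, h₂, hc, hr, hu⟩ := hg.exists_split hx₀
  refine IsGraph.node (x := x) (m := m) (l := l) (r := r)
    (h₁ := PMap.restrict h' {a | a = x ∨ a = x + 1 ∨ a = x + 2}) (h₂ := h₂) ?_ ?_ ?_ ?_
  · rw [PMap.update_apply, if_pos rfl]
  · intro a
    simp only [PMap.restrict_apply, Set.mem_ofPred_eq, hh]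
    grind
  · rw [PMap.erase_update]
    exact hr
  · constructor
    · intro a
      have h1 := hu.1 a
      rw [hc a] at h1
      simp only [PMap.restrict_apply, Set.mem_ofPred_eq]
      grind
    · intro a
      have h1 := hu.1 a
      have h2 := hu.2 a
      rw [hc a] at h1 h2
      simp only [PMap.restrict_apply, Set.mem_ofPred_eq, hh]
      split_ifs at * <;> simp_all

/-! ### Determinism of execution and a calculus for total correctness -/

theorem Exec.deterministic {c : Cmd} {σ : State} {o o' : Outcome} (h : Exec c σ o)
    (h' : Exec c σ o') : o = o' := by
  induction h generalizing o' with
  | assign => cases h'; rfl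
  | load x y f σ a v ha hv =>
    cases h' with
    | load _ _ _ _ a' v' ha' hv' => grind
    | load_fault _ _ _ _ hf => simp [hf a ha] at hv
  | load_fault x y f σ hf =>
    cases h' with
    | load _ _ _ _ a' v' ha' hv' => simp [hf a' ha'] at hv'
    | load_fault => rfl
  | store y f e σ a ha hv =>
    cases h' with
    | store _ _ _ _ a' ha' hv' => rw [ha] at ha'; cases ha'; rfl
    | store_fault _ _ _ _ hf => exact absurd (hf a ha) hv
  | store_fault y f e σ hf =>
    cases h' with
    | store _ _ _ _ a' ha' hv' => exact absurd (hf a' ha') hv'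
    | store_fault => rfl
  | seq c₁ c₂ σ σ' o _ _ ih₁ ih₂ =>
    cases h' with
    | seq _ _ _ σ'' _ g₁ g₂ => cases ih₁ g₁; exact ih₂ g₂
    | seq_fault _ _ _ g => cases ih₁ g
  | seq_fault c₁ c₂ σ _ ih =>
    cases h' with
    | seq _ _ _ σ'' _ g₁ g₂ => cases ih g₁
    | seq_fault => rfl
  | ite_true e c₁ c₂ σ o he _ ih =>
    cases h' with
    | ite_true _ _ _ _ _ _ g => exact ih g
    | ite_false _ _ _ _ _ he' => exact absurd he he'
  | ite_false e c₁ c₂ σ o he _ ih =>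
    cases h' with
    | ite_true _ _ _ _ _ he' => exact absurd he' he
    | ite_false _ _ _ _ _ _ g => exact ih g
  | while_false e c σ he =>
    cases h' with
    | while_false => rfl
    | while_true _ _ _ _ _ he' => exact absurd he' he
    | while_fault _ _ _ he' => exact absurd he' he
  | while_true e c σ σ' o he _ _ ih₁ ih₂ =>
    cases h' with
    | while_false _ _ _ he' => exact absurd he he'
    | while_true _ _ _ σ'' _ _ g₁ g₂ => cases ih₁ g₁; exact ih₂ g₂
    | while_fault _ _ _ _ g => cases ih₁ g
  | while_fault e c σ he _ ih =>
    cases h' with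
    | while_false _ _ _ he' => exact absurd he he'
    | while_true _ _ _ σ'' _ _ g₁ g₂ => cases ih g₁
    | while_fault => rfl

/-- Some execution of `c` from `σ` ends in a state satisfying `Q`. -/
def Wp (c : Cmd) (Q : Assertion) (σ : State) : Prop := ∃ σ', Exec c σ (.ok σ') ∧ Q σ'

/-- By determinism a single successful run excludes faults and is the only run, so the three clauses
of `Triple` collapse to one. -/
theorem triple_iff_wp {P Q : Assertion} {c : Cmd} : Triple P c Q ↔ ∀ σ, P σ → Wp c Q σ := by
  constructor
  · intro h σ hσ
    obtain ⟨-, ⟨σ', h₁⟩, h₂⟩ := h σ hσ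
    exact ⟨σ', h₁, h₂ σ' h₁⟩
  · intro h σ hσ
    obtain ⟨σ', h₁, h₂⟩ := h σ hσ
    refine ⟨fun hf => ?_, ⟨σ', h₁⟩, fun σ'' h₃ => ?_⟩
    · cases h₁.deterministic hf
    · cases h₁.deterministic h₃
      exact h₂

theorem Wp.mono {c : Cmd} {P Q : Assertion} {σ : State} (h : Wp c P σ) (hPQ : ∀ σ', P σ' → Q σ') :
    Wp c Q σ :=
  let ⟨σ', h₁, h₂⟩ := h
  ⟨σ', h₁, hPQ σ' h₂⟩

theorem Wp.assign {x : Var} {e : Expr} {Q : Assertion} {σ : State}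
    (h : Q ⟨Function.update σ.store x (e.eval σ.store), σ.heap⟩) : Wp (.assign x e) Q σ :=
  ⟨_, .assign x e σ, h⟩

theorem Wp.load {x y : Var} {f : Field} {Q : Assertion} {σ : State} {a : ℕ} {v : Val}
    (ha : σ.store y = .ptr a) (hv : σ.heap (a + f.offset) = some v)
    (h : Q ⟨Function.update σ.store x v, σ.heap⟩) : Wp (.load x y f) Q σ :=
  ⟨_, .load x y f σ (a + f.offset) v (by simp [address, ha]) hv, h⟩

theorem Wp.store {y : Var} {f : Field} {e : Expr} {Q : Assertion} {σ : State} {a : ℕ}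
    (ha : σ.store y = .ptr a) (hv : σ.heap (a + f.offset) ≠ none)
    (h : Q ⟨σ.store, PMap.update σ.heap (a + f.offset) (e.eval σ.store) hv⟩) :
    Wp (.store y f e) Q σ :=
  ⟨_, .store y f e σ (a + f.offset) (by simp [address, ha]) hv, h⟩

theorem Wp.seq {c₁ c₂ : Cmd} {Q : Assertion} {σ : State} (h : Wp c₁ (Wp c₂ Q) σ) :
    Wp (.seq c₁ c₂) Q σ :=
  let ⟨σ', h₁, σ'', h₂, h₃⟩ := h
  ⟨σ'', .seq _ _ _ σ' _ h₁ h₂, h₃⟩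

theorem Wp.ite_true {e : Expr} {c₁ c₂ : Cmd} {Q : Assertion} {σ : State}
    (he : e.eval σ.store = .bool true) (h : Wp c₁ Q σ) : Wp (.ite e c₁ c₂) Q σ :=
  let ⟨σ', h₁, h₂⟩ := h
  ⟨σ', .ite_true _ _ _ _ _ he h₁, h₂⟩

theorem Wp.ite_false {e : Expr} {c₁ c₂ : Cmd} {Q : Assertion} {σ : State}
    (he : e.eval σ.store ≠ .bool true) (h : Wp c₂ Q σ) : Wp (.ite e c₁ c₂) Q σ :=
  let ⟨σ', h₁, h₂⟩ := h
  ⟨σ', .ite_false _ _ _ _ _ he h₁, h₂⟩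

/-- Total correctness of loops, by an invariant indexed by a natural number that the loop body
decreases. -/
theorem Wp.while {e : Expr} {c : Cmd} {I : ℕ → Assertion}
    (hI : ∀ n σ, I n σ → e.eval σ.store = .bool true → Wp c (fun σ' => ∃ k < n, I k σ') σ)
    (n : ℕ) : ∀ σ, I n σ →
      Wp (.while e c) (fun σ' => (∃ k, I k σ') ∧ e.eval σ'.store ≠ .bool true) σ := by
  induction n using Nat.strong_induction_on with
  | _ n ih =>
    intro σ hσ
    by_cases he : e.eval σ.store = .bool true
    · obtain ⟨σ', h₁, k, hk, h₂⟩ := hI n σ hσ he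
      obtain ⟨σ'', h₃, h₄⟩ := ih k hk σ' h₂
      exact ⟨σ'', .while_true _ _ _ σ' _ he h₁ h₃, h₄⟩
    · exact ⟨σ, .while_false _ _ _ he, ⟨n, hσ⟩, he⟩

end SchorrWaite

namespace SchorrWaite

open BinaryGraph

/-! ### Nodes, filtering and reachability -/

namespace BinaryGraph

variable {T : Type}

theorem mem_nodes {γ : BinaryGraph T} {x : ℕ} : x ∈ γ.nodes ↔ γ x ≠ none := Iff.rfl

theorem mem_nodes₀ {γ : BinaryGraph T} {x : ℕ} : x ∈ γ.nodes₀ ↔ x = 0 ∨ γ x ≠ none := Iff.rfl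

theorem closed_iff {γ : BinaryGraph T} :
    γ.Closed ↔ ∀ x v l r, γ x = some (v, l, r) → l ∈ γ.nodes₀ ∧ r ∈ γ.nodes₀ := by
  constructor
  · intro h x v l r hx
    have hxn : x ∈ γ.nodes := by simp [mem_nodes, hx]
    exact ⟨h (Set.mem_biUnion hxn ⟨v, l, r, hx, Or.inl rfl⟩),
      h (Set.mem_biUnion hxn ⟨v, l, r, hx, Or.inr rfl⟩)⟩
  · intro h y hy
    obtain ⟨x, -, v, l, r, hx, rfl | rfl⟩ := Set.mem_iUnion₂.1 hy
    exacts [(h x v _ r hx).1, (h x v l _ hx).2]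

theorem val_eq_some {γ : BinaryGraph T} {x : ℕ} {v : T} :
    γ.val x = some v ↔ ∃ l r, γ x = some (v, l, r) := by
  simp [val]

theorem filter_apply_of_mem {γ : BinaryGraph T} {V : Set T} {x : ℕ} {v : T} {l r : ℕ}
    (hx : γ x = some (v, l, r)) (hv : v ∈ V) : γ.filter V x = some (v, l, r) := by
  rw [filter, PMap.restrict_apply, if_pos ⟨v, hv, val_eq_some.2 ⟨l, r, hx⟩⟩, hx]

theorem filter_apply_of_notMem {γ : BinaryGraph T} {V : Set T} {x : ℕ} {v : T} {l r : ℕ}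
    (hx : γ x = some (v, l, r)) (hv : v ∉ V) : γ.filter V x = none := by
  rw [filter, PMap.restrict_apply, if_neg]
  rintro ⟨w, hw, h⟩
  simp only [val, hx, Option.map_some, Option.some.injEq] at h
  exact hv (h ▸ hw)

theorem filter_apply_of_none {γ : BinaryGraph T} {V : Set T} {x : ℕ} (hx : γ x = none) :
    γ.filter V x = none := by
  rw [filter, PMap.restrict_apply, hx, ite_self]

theorem mem_nodes_filter {γ : BinaryGraph T} {V : Set T} {x : ℕ} :
    x ∈ (γ.filter V).nodes ↔ ∃ v l r, γ x = some (v, l, r) ∧ v ∈ V := by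
  rw [mem_nodes]
  rcases hx : γ x with _ | ⟨v, l, r⟩
  · simp [filter_apply_of_none hx]
  · by_cases hv : v ∈ V
    · simp [filter_apply_of_mem hx hv, hv]
    · simp [filter_apply_of_notMem hx hv, hv]

theorem left_eq {γ : BinaryGraph T} {x : ℕ} {v : T} {l r : ℕ} (hx : γ x = some (v, l, r)) :
    γ.left x = l := by
  simp [left, hx]

theorem right_eq {γ : BinaryGraph T} {x : ℕ} {v : T} {l r : ℕ} (hx : γ x = some (v, l, r)) :
    γ.right x = r := by
  simp [right, hx]

/-- There is a path in `γ` from its node `x` to its node `z`. -/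
inductive Connected (γ : BinaryGraph T) : ℕ → ℕ → Prop where
  | refl {x : ℕ} {v : T} {l r : ℕ} (hx : γ x = some (v, l, r)) : Connected γ x x
  | left {x z : ℕ} {v : T} {l r : ℕ} (hx : γ x = some (v, l, r)) (h : Connected γ l z) :
      Connected γ x z
  | right {x z : ℕ} {v : T} {l r : ℕ} (hx : γ x = some (v, l, r)) (h : Connected γ r z) :
      Connected γ x z

theorem Connected.source_ne_none {γ : BinaryGraph T} {x z : ℕ} (h : Connected γ x z) :
    γ x ≠ none := by
  cases h <;> simp [*]

theorem Connected.target_ne_none {γ : BinaryGraph T} {x z : ℕ} (h : Connected γ x z) :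
    γ z ≠ none := by
  induction h with
  | refl hx => simp [hx]
  | left _ _ ih => exact ih
  | right _ _ ih => exact ih

theorem Connected.of_erase {γ : BinaryGraph T} {y x z : ℕ} (h : Connected (PMap.erase γ y) x z) :
    Connected γ x z := by
  have key : ∀ {x : ℕ} {c : T × ℕ × ℕ}, PMap.erase γ y x = some c → γ x = some c := by
    intro x c hx
    rw [PMap.erase_apply] at hx
    split_ifs at hx
    exact hx
  induction h with
  | refl hx => exact .refl (key hx)
  | left hx _ ih => exact .left (key hx) ih
  | right hx _ ih => exact .right (key hx) ih

/-- A path either avoids the node `y`, or continues after its last visit to `y` avoiding `y`. -/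
theorem Connected.erase {γ : BinaryGraph T} {a z : ℕ} (h : Connected γ a z) {y l r : ℕ} {v : T}
    (hy : γ y = some (v, l, r)) :
    Connected (PMap.erase γ y) a z ∨ z = y ∨ Connected (PMap.erase γ y) l z ∨
      Connected (PMap.erase γ y) r z := by
  have key : ∀ {x : ℕ} {c : T × ℕ × ℕ}, x ≠ y → γ x = some c → PMap.erase γ y x = some c := by
    intro x c hxy hx
    rw [PMap.erase_apply, if_neg hxy, hx]
  induction h with
  | @refl x _ _ _ hx =>
    by_cases hxy : x = y
    · exact Or.inr (Or.inl hxy)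
    · exact Or.inl (.refl (key hxy hx))
  | @left x _ _ _ _ hx _ ih =>
    by_cases hxy : x = y
    · subst hxy
      rw [hx] at hy
      cases hy
      tauto
    · rcases ih with ih | ih
      · exact Or.inl (.left (key hxy hx) ih)
      · exact Or.inr ih
  | @right x _ _ _ _ hx _ ih =>
    by_cases hxy : x = y
    · subst hxy
      rw [hx] at hy
      cases hy
      tauto
    · rcases ih with ih | ih
      · exact Or.inl (.right (key hxy hx) ih)
      · exact Or.inr ih

/-- The recursion forbids returning to `x`, but this loses nothing: a path from `x` to `z` can be
cut at its last visit to `x`, after which it avoids `x`. The induction is on the number of nodes. -/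
theorem mem_reach {γ : BinaryGraph T} {x z : ℕ} : z ∈ reach γ x ↔ Connected γ x z := by
  induction hn : γ.nodes.ncard using Nat.strong_induction_on generalizing γ x with
  | _ n ih =>
    rw [reach]
    split_ifs with hx
    · obtain ⟨⟨v, l, r⟩, hc⟩ := Option.ne_none_iff_exists'.1 hx
      have ih' : ∀ w, z ∈ reach (PMap.erase γ x) w ↔ Connected (PMap.erase γ x) w z := fun w =>
        ih _ (hn ▸ ncard_nodes_erase_lt γ hx) rfl
      rw [left_eq hc, right_eq hc, Set.mem_union, Set.mem_union, Set.mem_singleton_iff, ih', ih']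
      constructor
      · rintro (rfl | h | h)
        exacts [.refl hc, .left hc h.of_erase, .right hc h.of_erase]
      · intro h
        rcases h.erase hc with h | h
        -- No path starts at `x` once `x` is erased.
        · exact absurd (by simp [PMap.erase_apply]) h.source_ne_none
        · exact h
    · simp only [Set.mem_empty_iff_false, false_iff]
      exact fun h => hx h.source_ne_none

end BinaryGraph

theorem mem_marked₀ {γ : BinaryGraph Mark} {x : ℕ} :
    x ∈ marked₀ γ ↔ x = 0 ∨ ∃ m l r, γ x = some (m, l, r) ∧ m ≠ .O := by
  have h : x ∈ marked₀ γ ↔ x = 0 ∨ x ∈ (γ.filter {.L, .R, .X}).nodes := Iff.rfl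
  rw [h, mem_nodes_filter]
  have h' : ∀ m : Mark, m ∈ ({.L, .R, .X} : Set Mark) ↔ m ≠ .O := by
    intro m
    cases m <;> simp
  simp only [h']

/-! ### Predecessors and successors in the stack -/

theorem prev_append_of_mem {α : List ℕ} {x : ℕ} (hx : x ∈ α) (y : ℕ) :
    prev (α ++ [y]) x = prev α x := by
  have h := List.idxOf_lt_length_of_mem hx
  rw [prev, prev, if_pos (List.mem_append_left _ hx), if_pos hx, List.idxOf_append_of_mem hx,
    ← List.cons_append, List.getD_append _ _ _ _ (by simp; omega)]

/-- Prepending `null` shifts positions by one, so the index of `x` in `α ++ [x]`, read in `null ::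
α`, points at the last entry. -/
theorem prev_append_self {α : List ℕ} {x : ℕ} (hx : x ∉ α) :
    prev (α ++ [x]) x = (null :: α).getLast (List.cons_ne_nil _ _) := by
  rw [prev, if_pos (by simp), List.idxOf_append_of_notMem hx, List.idxOf_cons_self,
    ← List.cons_append, List.getD_append _ _ _ _ (by simp), List.getLast_eq_getElem,
    List.getD_eq_getElem _ _ (by simp)]
  simp

/-- The successor of an element of `α` already lies in `α ++ [y]`, so the tip `t` has no influence.
Hence a tip may become a stack element, or a stack element the tip, without disturbing `restore`
below it. -/
theorem next_append_of_mem {α : List ℕ} {x : ℕ} (hx : x ∈ α) (y t : ℕ) :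
    next (α ++ [y]) t x = next α y x := by
  have h := List.idxOf_lt_length_of_mem hx
  rw [next, next, if_pos (List.mem_append_left _ hx), if_pos hx, List.idxOf_append_of_mem hx,
    List.getD_append _ _ _ _ (by simp; omega), List.getD_eq_getElem _ _ (by simp; omega),
    List.getD_eq_getElem _ _ (by simp; omega)]

theorem next_append_self {α : List ℕ} {x : ℕ} (hx : x ∉ α) (t : ℕ) :
    next (α ++ [x]) t x = t := by
  rw [next, if_pos (by simp), List.idxOf_append_of_notMem hx, List.idxOf_cons_self,
    List.getD_append_right _ _ _ _ (by simp)]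
  simp

/-! ### The invariant is preserved by the three graph updates -/

theorem inset_eq_erasure_iff {α : List ℕ} {γ : BinaryGraph Mark} :
    inset α γ = γ.erasure ↔
      (∀ x l r, γ x = some (.L, l, r) → prev α x = l) ∧
        ∀ x l r, γ x = some (.R, l, r) → prev α x = r := by
  constructor
  · intro h
    constructor <;> intro x l r hx <;>
      simpa [inset, erasure, BinaryGraph.map, hx, ifMark] using congrArg (fun g => g.toFun x) h
  · rintro ⟨h₁, h₂⟩
    apply PMap.coe_injective
    intro x
    show (γ x).map (ifMark (prev α) x) = (γ x).map fun c => ((), c.2)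
    rcases hx : γ x with _ | ⟨_ | _ | _ | _, l, r⟩
    · rfl
    · rfl
    · simp [ifMark, h₁ x l r hx]
    · simp [ifMark, h₂ x l r hx]
    · rfl

theorem ifMark_congr {f g : ℕ → ℕ} {x : ℕ} {c : Mark × ℕ × ℕ}
    (h : c.1 = .L ∨ c.1 = .R → f x = g x) : ifMark f x c = ifMark g x c := by
  obtain ⟨_ | _ | _ | _, l, r⟩ := c <;> simp_all [ifMark]

/-- Restoration is nodewise: only the overwritten node and the nodes with a reversed pointer need to
be compared. -/
theorem restore_update {γ : BinaryGraph Mark} {α α' : List ℕ} {t t' x l r l' r' : ℕ} {m m' : Mark}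
    (hx : γ x = some (m, l, r)) (hx' : γ x ≠ none)
    (hc : ifMark (next α' t') x (m', l', r') = ifMark (next α t) x (m, l, r))
    (h : ∀ y m l r, y ≠ x → γ y = some (m, l, r) → m = .L ∨ m = .R →
      next α' t' y = next α t y) :
    restore t' α' (PMap.update γ x (m', l', r') hx') = restore t α γ := by
  apply PMap.coe_injective
  intro y
  show (PMap.update γ x (m', l', r') hx' y).map (ifMark (next α' t') y) =
    (γ y).map (ifMark (next α t) y)
  rw [PMap.update_apply]
  split_ifs with hy
  · subst hy
    rw [hx, Option.map_some, Option.map_some, hc]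
  · rcases hg : γ y with _ | ⟨m, l, r⟩
    · rfl
    · rw [Option.map_some, Option.map_some, ifMark_congr (h y m l r hy hg)]

/-! ### Closedness and filtered subgraphs under an update at one node. -/

namespace BinaryGraph

theorem mem_nodes₀_update {T : Type} {γ : BinaryGraph T} {x : ℕ} {c : T × ℕ × ℕ}
    (hx : γ x ≠ none) {y : ℕ} : y ∈ nodes₀ (PMap.update γ x c hx) ↔ y ∈ γ.nodes₀ := by
  rw [mem_nodes₀, mem_nodes₀, PMap.update_apply]
  split_ifs with h
  · subst h
    simp [hx]
  · rfl

theorem Closed.update {T : Type} {γ : BinaryGraph T} (hγ : γ.Closed) {x : ℕ} {v : T} {l r : ℕ}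
    (hx : γ x ≠ none) (hl : l ∈ γ.nodes₀) (hr : r ∈ γ.nodes₀) :
    Closed (PMap.update γ x (v, l, r) hx) := by
  rw [closed_iff] at hγ ⊢
  intro y w l' r' hy
  rw [mem_nodes₀_update, mem_nodes₀_update]
  rw [PMap.update_apply] at hy
  split_ifs at hy with h
  · cases hy
    exact ⟨hl, hr⟩
  · exact hγ y w l' r' hy

theorem filter_update_of_notMem {T : Type} {γ : BinaryGraph T} {V : Set T} {x : ℕ} {v v' : T}
    {l r l' r' : ℕ} (hx : γ x = some (v, l, r)) (hv : v ∉ V) (hv' : v' ∉ V) (hx' : γ x ≠ none) :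
    filter (PMap.update γ x (v', l', r') hx') V = γ.filter V := by
  apply PMap.coe_injective
  intro y
  by_cases hy : y = x
  · subst hy
    rw [filter_apply_of_notMem hx hv,
      filter_apply_of_notMem (by rw [PMap.update_apply, if_pos rfl]) hv']
  · have h : PMap.update γ x (v', l', r') hx' y = γ y := by rw [PMap.update_apply, if_neg hy]
    rcases hg : γ y with _ | ⟨w, a, b⟩
    · rw [filter_apply_of_none hg, filter_apply_of_none (h.trans hg)]
    · by_cases hw : w ∈ V
      · rw [filter_apply_of_mem hg hw, filter_apply_of_mem (h.trans hg) hw]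
      · rw [filter_apply_of_notMem hg hw, filter_apply_of_notMem (h.trans hg) hw]

theorem filter_update_eq_erase {T : Type} {γ : BinaryGraph T} {V : Set T} {x : ℕ} {v' : T}
    {l' r' : ℕ} (hv' : v' ∉ V) (hx : γ x ≠ none) :
    filter (PMap.update γ x (v', l', r') hx) V = PMap.erase (γ.filter V) x := by
  apply PMap.coe_injective
  intro y
  rw [PMap.erase_apply]
  by_cases hy : y = x
  · subst hy
    rw [if_pos rfl, filter_apply_of_notMem (by rw [PMap.update_apply, if_pos rfl]) hv']
  · have h : PMap.update γ x (v', l', r') hx y = γ y := by rw [PMap.update_apply, if_neg hy]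
    rw [if_neg hy]
    rcases hg : γ y with _ | ⟨w, a, b⟩
    · rw [filter_apply_of_none hg, filter_apply_of_none (h.trans hg)]
    · by_cases hw : w ∈ V
      · rw [filter_apply_of_mem hg hw, filter_apply_of_mem (h.trans hg) hw]
      · rw [filter_apply_of_notMem hg hw, filter_apply_of_notMem (h.trans hg) hw]

end BinaryGraph

/-! ### Consequences of the invariant and its preservation. -/

namespace Inv'

variable {γ₀ γ : BinaryGraph Mark} {α : List ℕ} {t p : ℕ}

theorem mem_stack (h : Inv' γ₀ γ α t p) {x : ℕ} :
    x ∈ α ↔ ∃ m l r, γ x = some (m, l, r) ∧ (m = .L ∨ m = .R) := by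
  have h' := Set.ext_iff.1 h.stack x
  rw [mem_nodes_filter] at h'
  exact h'.symm

theorem p_mem (h : Inv' γ₀ γ α t p) : p = 0 ∨ p ∈ α := by
  rw [h.p_eq]
  exact List.mem_cons.1 (List.getLast_mem (List.cons_ne_nil null α))

theorem p_mem_nodes₀ (h : Inv' γ₀ γ α t p) : p ∈ γ.nodes₀ := by
  rw [mem_nodes₀]
  refine h.p_mem.imp_right fun hp => ?_
  obtain ⟨m, l, r, hx, -⟩ := h.mem_stack.1 hp
  simp [hx]

/-- If `p` is not null, the stack ends in `p`. -/
theorem exists_eq_append (h : Inv' γ₀ γ α t p) (hp : p ≠ 0) : ∃ β, α = β ++ [p] := by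
  rcases List.eq_nil_or_concat α with rfl | ⟨β, y, rfl⟩
  · exact absurd h.p_eq hp
  · have h' := h.p_eq
    rw [List.concat_eq_append] at h' ⊢
    simp only [← List.cons_append, List.getLast_append_singleton] at h'
    exact ⟨β, by rw [h']⟩

theorem unmarked_connected (h : Inv' γ₀ γ α t p) {z : ℕ} (hz : z ∈ (γ.filter {.O}).nodes) :
    (∃ y ∈ α, Connected (γ.filter {.O}) (γ.right y) z) ∨ Connected (γ.filter {.O}) t z := by
  have h' := h.unmarked hz
  simp only [Set.mem_union, Set.mem_iUnion, Set.mem_ofPred_eq, mem_reach, exists_prop] at h'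
  exact h'

/-- The old top `p` goes into the left field of `t`, and the displaced child `l` becomes the tip,
where `restore` looks for it. An unmarked path through `t` continues, after its last visit to `t`,
from `l` or from `r`; the former is the new tip, the latter the right child of the new stack
element. -/
theorem push (h : Inv' γ₀ γ α t p) {l r : ℕ} (ht : γ t = some (.O, l, r)) (ht' : γ t ≠ none) :
    Inv' γ₀ (PMap.update γ t (.L, p, r) ht') (α ++ [t]) l t := by
  have htα : t ∉ α := by
    rw [h.mem_stack]
    simp [ht]
  have hlr := closed_iff.1 h.closed t _ l r ht
  obtain ⟨hL, hR⟩ := inset_eq_erasure_iff.1 h.inset_eq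
  refine ⟨?_, ?_, ?_, ?_, ?_, ?_, ?_, ?_⟩
  · rw [← List.cons_append]
    refine List.nodup_append.2 ⟨h.uniq, List.nodup_singleton _, ?_⟩
    intro a ha b hb
    rw [List.mem_singleton] at hb
    subst hb
    rintro rfl
    rcases List.mem_cons.1 ha with h0 | ha
    · exact PMap.ne_null_of_ne_none _ ht' h0
    · exact htα ha
  · simp
  · exact (mem_nodes₀_update ht').2 hlr.1
  · exact h.closed.update ht' h.p_mem_nodes₀ hlr.2
  · ext x
    rw [mem_nodes_filter, Set.mem_ofPred_eq, List.mem_append, List.mem_singleton, h.mem_stack,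
      PMap.update_apply]
    split_ifs with hx
    · simp [hx]
    · simp [hx]
  · rw [inset_eq_erasure_iff]
    constructor
    · intro x l' r' hx
      rw [PMap.update_apply] at hx
      split_ifs at hx with hxt
      · cases hx
        rw [hxt, prev_append_self htα, ← h.p_eq]
      · rw [prev_append_of_mem (h.mem_stack.2 ⟨_, _, _, hx, Or.inl rfl⟩), hL x l' r' hx]
    · intro x l' r' hx
      rw [PMap.update_apply] at hx
      split_ifs at hx with hxt
      · cases hx
      · rw [prev_append_of_mem (h.mem_stack.2 ⟨_, _, _, hx, Or.inr rfl⟩), hR x l' r' hx]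
  · rw [← h.restore_eq]
    refine restore_update ht ht' ?_ ?_
    · simp [ifMark, next_append_self htα]
    · intro y m l r _ hy hm
      rw [next_append_of_mem (h.mem_stack.2 ⟨m, l, r, hy, hm⟩)]
  · rw [filter_update_eq_erase (by simp)]
    intro z hz
    have hzt : z ≠ t := by
      rintro rfl
      simp [mem_nodes, PMap.erase_apply] at hz
    have hz' : z ∈ (γ.filter {.O}).nodes := by
      rw [mem_nodes, PMap.erase_apply, if_neg hzt] at hz
      exact hz
    have htf : γ.filter {.O} t = some (.O, l, r) := filter_apply_of_mem ht rfl
    simp only [Set.mem_union, Set.mem_iUnion, Set.mem_ofPred_eq, mem_reach, exists_prop]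
    have hright : right (PMap.update γ t (.L, p, r) ht') t = r :=
      right_eq (by rw [PMap.update_apply, if_pos rfl])
    have key : Connected (PMap.erase (γ.filter {.O}) t) l z ∨
        Connected (PMap.erase (γ.filter {.O}) t) r z →
        (∃ y ∈ α ++ [t], Connected (PMap.erase (γ.filter {.O}) t)
          (right (PMap.update γ t (.L, p, r) ht') y) z) ∨
          Connected (PMap.erase (γ.filter {.O}) t) l z := by
      rintro (hc | hc)
      · exact Or.inr hc
      · exact Or.inl ⟨t, by simp, by rwa [hright]⟩
    rcases h.unmarked_connected hz' with ⟨y, hy, hc⟩ | hc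
    · rcases hc.erase htf with hc | hc | hc
      · refine Or.inl ⟨y, List.mem_append_left _ hy, ?_⟩
        have hyt : y ≠ t := fun e => htα (e ▸ hy)
        rwa [right, PMap.update_apply, if_neg hyt]
      · exact absurd hc hzt
      · exact key hc
    · rcases hc.erase htf with hc | hc | hc
      -- This path would start at the erased node `t`.
      · exact absurd (by simp [PMap.erase_apply]) hc.source_ne_none
      · exact absurd hc hzt
      · exact key hc

/-- A marked or null tip is not a node of the unmarked subgraph, so the tip's term in `unmarked` is
empty. -/
theorem not_connected_of_marked {z : ℕ} (ht : t ∈ marked₀ γ) :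
    ¬ Connected (γ.filter {.O}) t z := by
  intro hc
  obtain ⟨m, l, r, hm, hO⟩ := mem_nodes_filter.1 (mem_nodes.2 hc.source_ne_none)
  rcases mem_marked₀.1 ht with rfl | ⟨m', l', r', hm', hne⟩
  · exact hc.source_ne_none (PMap.null_undef _)
  · rw [hm] at hm'
    cases hm'
    exact hne hO

/-- The stack stays the same; the back pointer `l` moves from the left field of `p` to the right
one, and the left field regains the finished child `t`. The right child `r`, so far a source of
unmarked paths as `γ.right p`, remains one as the new tip. -/
theorem swing (h : Inv' γ₀ γ α t p) (ht : t ∈ marked₀ γ) {l r : ℕ}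
    (hp : γ p = some (.L, l, r)) (hp' : γ p ≠ none) :
    Inv' γ₀ (PMap.update γ p (.R, t, l) hp') α r p := by
  obtain ⟨β, rfl⟩ := h.exists_eq_append (PMap.ne_null_of_ne_none _ hp')
  have hpβ : p ∉ β := by
    have := h.uniq
    rw [← List.cons_append] at this
    have := (List.nodup_append.1 this).2.2
    exact fun hm => this p (List.mem_cons_of_mem _ hm) p (by simp) rfl
  have hlr := closed_iff.1 h.closed p _ l r hp
  obtain ⟨hL, hR⟩ := inset_eq_erasure_iff.1 h.inset_eq
  refine ⟨h.uniq, h.p_eq, (mem_nodes₀_update hp').2 hlr.2, h.closed.update hp' h.t_mem hlr.1,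
    ?_, ?_, ?_, ?_⟩
  · ext x
    rw [mem_nodes_filter, Set.mem_ofPred_eq, h.mem_stack, PMap.update_apply]
    split_ifs with hx
    · simp [hx, hp]
    · simp
  · rw [inset_eq_erasure_iff]
    constructor
    · intro x l' r' hx
      rw [PMap.update_apply] at hx
      split_ifs at hx with hxp
      · cases hx
      · exact hL x l' r' hx
    · intro x l' r' hx
      rw [PMap.update_apply] at hx
      split_ifs at hx with hxp
      · cases hx
        subst hxp
        -- The new right field holds the old left one, which was the predecessor since `p` was
        -- marked `L`.
        exact hL x l r hp
      · exact hR x l' r' hx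
  · rw [← h.restore_eq]
    refine restore_update hp hp' ?_ ?_
    -- Both sides restore the children of `p` to `t` and `r`.
    · simp [ifMark, next_append_self hpβ]
    · intro y m l r hyp hy hm
      have hyα := h.mem_stack.2 ⟨m, l, r, hy, hm⟩
      rw [List.mem_append, List.mem_singleton, or_iff_left hyp] at hyα
      rw [next_append_of_mem hyα, next_append_of_mem hyα]
  · rw [filter_update_of_notMem hp (by simp) (by simp)]
    intro z hz
    simp only [Set.mem_union, Set.mem_iUnion, Set.mem_ofPred_eq, mem_reach, exists_prop]
    rcases h.unmarked_connected hz with ⟨y, hy, hc⟩ | hc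
    · by_cases hyp : y = p
      · subst hyp
        rw [right_eq hp] at hc
        exact Or.inr hc
      · refine Or.inl ⟨y, hy, ?_⟩
        rwa [right, PMap.update_apply, if_neg hyp]
    · exact absurd hc (not_connected_of_marked ht)

/-- The top `p` leaves the stack and becomes the tip, so the stack nodes below keep their
successors; `p` itself gets back its right child `t`. -/
theorem pop (h : Inv' γ₀ γ α t p) (ht : t ∈ marked₀ γ) {l r : ℕ}
    (hp : γ p = some (.R, l, r)) (hp' : γ p ≠ none) :
    ∃ β, Inv' γ₀ (PMap.update γ p (.X, l, t) hp') β p r := by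
  obtain ⟨β, rfl⟩ := h.exists_eq_append (PMap.ne_null_of_ne_none _ hp')
  have huniq := h.uniq
  rw [← List.cons_append] at huniq
  have hpβ : p ∉ β := by
    have := (List.nodup_append.1 huniq).2.2
    exact fun hm => this p (List.mem_cons_of_mem _ hm) p (by simp) rfl
  have hlr := closed_iff.1 h.closed p _ l r hp
  obtain ⟨hL, hR⟩ := inset_eq_erasure_iff.1 h.inset_eq
  -- As `p` is marked `R`, its right field is the back pointer, that is, the top of the shortened
  -- stack.
  have hr : r = (null :: β).getLast (List.cons_ne_nil _ _) := by
    rw [← prev_append_self hpβ, hR p l r hp]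
  have hstack : ∀ {x m l r}, x ≠ p → γ x = some (m, l, r) → m = .L ∨ m = .R → x ∈ β := by
    intro x m l r hxp hx hm
    have hxα := h.mem_stack.2 ⟨m, l, r, hx, hm⟩
    rwa [List.mem_append, List.mem_singleton, or_iff_left hxp] at hxα
  refine ⟨β, (List.nodup_append.1 huniq).1, hr, (mem_nodes₀_update hp').2 h.p_mem_nodes₀,
    h.closed.update hp' hlr.1 h.t_mem, ?_, ?_, ?_, ?_⟩
  · ext x
    rw [mem_nodes_filter, Set.mem_ofPred_eq, PMap.update_apply]
    split_ifs with hx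
    · simp [hx, hpβ]
    · have := h.mem_stack (x := x)
      rw [List.mem_append, List.mem_singleton, or_iff_left hx] at this
      rw [this]
      simp
  · rw [inset_eq_erasure_iff]
    constructor
    · intro x l' r' hx
      rw [PMap.update_apply] at hx
      split_ifs at hx with hxp
      · cases hx
      · rw [← hL x l' r' hx, prev_append_of_mem (hstack hxp hx (Or.inl rfl))]
    · intro x l' r' hx
      rw [PMap.update_apply] at hx
      split_ifs at hx with hxp
      · cases hx
      · rw [← hR x l' r' hx, prev_append_of_mem (hstack hxp hx (Or.inr rfl))]
  · rw [← h.restore_eq]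
    refine restore_update hp hp' ?_ ?_
    · simp [ifMark, next_append_self hpβ]
    · intro y m l r hyp hy hm
      rw [next_append_of_mem (hstack hyp hy hm)]
  · rw [filter_update_of_notMem hp (by simp) (by simp)]
    intro z hz
    simp only [Set.mem_union, Set.mem_iUnion, Set.mem_ofPred_eq, mem_reach, exists_prop]
    rcases h.unmarked_connected hz with ⟨y, hy, hc⟩ | hc
    · by_cases hyp : y = p
      · subst hyp
        rw [right_eq hp] at hc
        -- Dropping `p` loses no source of unmarked paths: its right field is null or a stack node,
        -- marked `L` or `R`.
        obtain ⟨m, a, b, hm, hO⟩ := mem_nodes_filter.1 (mem_nodes.2 hc.source_ne_none)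
        have hrβ := List.getLast_mem (List.cons_ne_nil null β)
        rw [← hr] at hrβ
        rcases List.mem_cons.1 hrβ with h0 | hrβ
        · exact absurd h0 (PMap.ne_null_of_ne_none _ hc.source_ne_none)
        · obtain ⟨m', a', b', hm', hLR⟩ := h.mem_stack.1 (List.mem_append_left _ hrβ)
          rw [hm] at hm'
          cases hm'
          rw [Set.mem_singleton_iff] at hO
          simp [hO] at hLR
      · rw [List.mem_append, List.mem_singleton, or_iff_left hyp] at hy
        refine Or.inl ⟨y, hy, ?_⟩
        rwa [right, PMap.update_apply, if_neg hyp]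
    · exact absurd hc (not_connected_of_marked ht)

/-- The invariant holds initially, with the empty stack. -/
theorem init {r : ℕ} (hc : γ₀.Closed) (hr : r ∈ γ₀.nodes)
    (hreach : γ₀.nodes = reach (γ₀.filter {.O}) r) : Inv' γ₀ γ₀ [] r 0 := by
  -- Nodes reachable in the unmarked subgraph belong to it, so the precondition forces every mark to
  -- be `O`.
  have hO : ∀ x m a b, γ₀ x = some (m, a, b) → m = .O := by
    intro x m a b hx
    have hxn : x ∈ reach (γ₀.filter {.O}) r := hreach ▸ (by simp [mem_nodes, hx])
    obtain ⟨m', a', b', hx', hm⟩ := mem_nodes_filter.1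
      (mem_nodes.2 (mem_reach.1 hxn).target_ne_none)
    rw [hx] at hx'
    cases hx'
    exact hm
  refine ⟨by simp, rfl, Or.inr hr, hc, ?_, ?_, ?_, ?_⟩
  · ext x
    rw [mem_nodes_filter]
    simp only [List.not_mem_nil, Set.mem_ofPred_eq, iff_false]
    rintro ⟨m, a, b, hx, hm⟩
    rw [hO x m a b hx] at hm
    simp at hm
  · rw [inset_eq_erasure_iff]
    constructor <;> intro x a b hx <;> cases hO x _ a b hx
  · apply PMap.coe_injective
    intro x
    show (γ₀ x).map (ifMark (next [] r) x) = (γ₀ x).map fun c => ((), c.2)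
    rcases hx : γ₀ x with _ | ⟨m, a, b⟩
    · rfl
    · cases hO x m a b hx
      rfl
  · intro z hz
    obtain ⟨m, a, b, hx, -⟩ := mem_nodes_filter.1 hz
    refine Or.inr (hreach ▸ ?_)
    simp [mem_nodes, hx]

/-- When the stack is empty and the tip is marked, every node is marked `X` and the graph has been
restored. -/
theorem final (h : Inv' γ₀ γ α t 0) (ht : t ∈ marked₀ γ) :
    γ₀.erasure = γ.erasure ∧ γ = γ.filter {.X} := by
  -- The last entry of `null :: α` is null, and by distinctness null occurs only at the head.
  have hα : α = [] := by
    rcases List.eq_nil_or_concat α with rfl | ⟨β, y, rfl⟩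
    · rfl
    · have h' := h.p_eq
      have hu := h.uniq
      rw [List.concat_eq_append] at h' hu
      simp only [← List.cons_append, List.getLast_append_singleton] at h'
      subst h'
      simp at hu
  subst hα
  have hX : ∀ x m a b, γ x = some (m, a, b) → m = .X := by
    intro x m a b hx
    have hst : ¬ (m = .L ∨ m = .R) := fun hm => by
      simpa using h.mem_stack.2 ⟨m, a, b, hx, hm⟩
    have hO : m ≠ .O := by
      rintro rfl
      rcases h.unmarked_connected (mem_nodes_filter.2 ⟨_, a, b, hx, rfl⟩) with ⟨y, hy, -⟩ | hc
      · simp at hy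
      · exact not_connected_of_marked ht hc
    cases m <;> simp_all
  constructor
  · rw [← h.restore_eq]
    apply PMap.coe_injective
    intro x
    show (γ x).map (ifMark (next [] t) x) = (γ x).map fun c => ((), c.2)
    rcases hx : γ x with _ | ⟨m, a, b⟩
    · rfl
    · cases hX x m a b hx
      rfl
  · apply PMap.coe_injective
    intro x
    rcases hx : γ x with _ | ⟨m, a, b⟩
    · rw [filter_apply_of_none hx]
    · rw [filter_apply_of_mem hx (hX x m a b hx)]

end Inv'

end SchorrWaite

namespace SchorrWaite

open BinaryGraph

/-! ### Termination measure -/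

/-- The number of times the algorithm still has to visit a node with the given mark. -/
def Mark.visits : Mark → ℕ
  | .O => 3
  | .L => 2
  | .R => 1
  | .X => 0

/-- The number of iterations still to be performed. -/
noncomputable def visits (γ : BinaryGraph Mark) : ℕ :=
  ∑ x ∈ γ.finite_dom.toFinset, ((γ x).map fun c => c.1.visits).getD 0

/-- Only the summand at `x` changes; this applies to the steps `O` to `L`, `L` to `R` and `R` to
`X`. -/
theorem visits_update_lt {γ : BinaryGraph Mark} {x l r l' r' : ℕ} {m m' : Mark}
    (hx : γ x = some (m, l, r)) (hx' : γ x ≠ none) (hm : m'.visits < m.visits) :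
    visits (PMap.update γ x (m', l', r') hx') < visits γ := by
  have hdom : (PMap.update γ x (m', l', r') hx').finite_dom.toFinset = γ.finite_dom.toFinset := by
    ext y
    rw [Set.Finite.mem_toFinset, Set.Finite.mem_toFinset, Set.mem_ofPred_eq, Set.mem_ofPred_eq,
      PMap.update_apply]
    split_ifs with hy
    · simp [hy, hx]
    · rfl
  rw [visits, visits, hdom]
  refine Finset.sum_lt_sum (fun y _ => ?_) ⟨x, by simpa using hx', ?_⟩
  · rw [PMap.update_apply]
    split_ifs with hy
    · simp [hy, hx, hm.le]
    · exact le_rfl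
  · simpa [PMap.update_apply, hx] using hm

/-! ### Correctness of the program fragments -/

variable {γ₀ γ : BinaryGraph Mark} {t p : ℕ} {σ : State}

theorem InvWith.mono {C C' : BinaryGraph Mark → ℕ → ℕ → Prop} (h : InvWith γ₀ C σ)
    (hC : ∀ γ t p, C γ t p → C' γ t p) : InvWith γ₀ C' σ := by
  obtain ⟨γ, t, p, ht, hp, hg, hi, hc⟩ := h
  exact ⟨γ, t, p, ht, hp, hg, hi, hC γ t p hc⟩

theorem wp_push (ht : σ.store .t = .ptr t) (hp : σ.store .p = .ptr p) (hg : IsGraph γ σ.heap)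
    (hi : Inv γ₀ γ t p) (htm : t ∉ marked₀ γ) :
    Wp push (InvWith γ₀ fun γ' _ _ => visits γ' < visits γ) σ := by
  obtain ⟨α, hi⟩ := hi
  rw [mem_marked₀, not_or] at htm
  have ht' : γ t ≠ none := (mem_nodes₀.1 hi.t_mem).resolve_left htm.1
  obtain ⟨⟨m, l, r⟩, hc⟩ := Option.ne_none_iff_exists'.1 ht'
  obtain rfl : m = .O := by
    by_contra hm
    exact htm.2 ⟨m, l, r, hc, hm⟩
  obtain ⟨hcm, hcl, hcr⟩ := hg.cells hc
  refine .seq (.load ht hcl (.seq (.store (a := t) (by simp [ht]) ?_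
    (.seq (.store (a := t) (by simp [ht]) ?_ (.seq (.assign (.assign ?_))))))))
  · simp [Field.offset, hcl]
  · simp [Field.offset, PMap.update_apply, hcm]
  · refine ⟨_, l, t, by simp [Expr.eval], by simp [Expr.eval, ht], ?_, ⟨_, hi.push hc ht'⟩,
      visits_update_lt hc ht' (by simp [Mark.visits])⟩
    -- The right cell is not written, but it already holds `r`.
    refine hg.update ht' _ _ _ _ fun a => ?_
    simp only [PMap.update_apply, Field.offset, Expr.eval]
    split_ifs <;> simp_all

theorem wp_swing (ht : σ.store .t = .ptr t) (hp : σ.store .p = .ptr p) (hg : IsGraph γ σ.heap)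
    (hi : Inv γ₀ γ t p) (htm : t ∈ marked₀ γ) (hv : γ.val p = some .L) :
    Wp swing (InvWith γ₀ fun γ' _ _ => visits γ' < visits γ) σ := by
  obtain ⟨α, hi⟩ := hi
  obtain ⟨l, r, hc⟩ := val_eq_some.1 hv
  have hp' : γ p ≠ none := by simp [hc]
  obtain ⟨hcm, hcl, hcr⟩ := hg.cells hc
  refine .seq (.load hp hcr (.seq (.load (a := p) (by simp [hp]) hcl
    (.seq (.store (a := p) (by simp [hp]) ?_ (.seq (.store (a := p) (by simp [hp]) ?_
      (.seq (.store (a := p) (by simp [hp]) ?_ (.assign ?_))))))))))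
  · simp [Field.offset, hcr]
  · simp [Field.offset, PMap.update_apply, hcl]
  · simp [Field.offset, PMap.update_apply, hcm]
  · refine ⟨_, r, p, by simp [Expr.eval], by simp [hp], ?_, ⟨_, hi.swing htm hc hp'⟩,
      visits_update_lt hc hp' (by simp [Mark.visits])⟩
    refine hg.update hp' _ _ _ _ fun a => ?_
    simp only [PMap.update_apply, Field.offset, Expr.eval]
    split_ifs <;> simp_all

theorem wp_pop (ht : σ.store .t = .ptr t) (hp : σ.store .p = .ptr p) (hg : IsGraph γ σ.heap)
    (hi : Inv γ₀ γ t p) (htm : t ∈ marked₀ γ) (hv : γ.val p = some .R) :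
    Wp pop (InvWith γ₀ fun γ' _ _ => visits γ' < visits γ) σ := by
  obtain ⟨α, hi⟩ := hi
  obtain ⟨l, r, hc⟩ := val_eq_some.1 hv
  have hp' : γ p ≠ none := by simp [hc]
  obtain ⟨hcm, hcl, hcr⟩ := hg.cells hc
  refine .seq (.load hp hcr (.seq (.store (a := p) (by simp [hp]) ?_
    (.seq (.store (a := p) (by simp [hp]) ?_ (.seq (.assign (.assign ?_))))))))
  · simp [Field.offset, hcr]
  · simp [Field.offset, PMap.update_apply, hcm]
  · refine ⟨_, p, r, by simp [Expr.eval, hp], by simp [Expr.eval], ?_, hi.pop htm hc hp',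
      visits_update_lt hc hp' (by simp [Mark.visits])⟩
    refine hg.update hp' _ _ _ _ fun a => ?_
    simp only [PMap.update_apply, Field.offset, Expr.eval]
    split_ifs <;> simp_all

/-- The loop invariant for graphs that satisfy `C`. -/
def LoopInvWith (γ₀ : BinaryGraph Mark) (C : BinaryGraph Mark → Prop) : Assertion := fun σ =>
  InvWith γ₀ (fun γ t _ => C γ ∧ ∃ b : Bool, σ.store .tm = .bool b ∧ (b = true ↔ t ∈ marked₀ γ)) σ

theorem LoopInvWith.loopInv {C : BinaryGraph Mark → Prop} (h : LoopInvWith γ₀ C σ) :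
    LoopInv γ₀ σ :=
  InvWith.mono h fun _ _ _ hc => hc.2

/-- A non-null tip is a node by `t_mem`, so the load cannot fault. The condition `C` carries the
termination bound past this fragment, which leaves the heap unchanged. -/
theorem wp_readMark {C : BinaryGraph Mark → Prop} (h : InvWith γ₀ (fun γ _ _ => C γ) σ) :
    Wp readMark (LoopInvWith γ₀ C) σ := by
  obtain ⟨γ, t, p, ht, hp, hg, hi, hC⟩ := h
  by_cases h0 : t = 0
  · refine .ite_true (by simp [Expr.eval, ht, h0]) (.assign ?_)
    refine ⟨γ, t, p, by simp [ht], by simp [hp], hg, hi, hC, true, by simp [Expr.eval], ?_⟩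
    simp [mem_marked₀, h0]
  · refine .ite_false (by simp [Expr.eval, ht, h0]) ?_
    obtain ⟨α, hi'⟩ := hi
    obtain ⟨⟨m, l, r⟩, hc⟩ :=
      Option.ne_none_iff_exists'.1 ((mem_nodes₀.1 hi'.t_mem).resolve_left h0)
    refine .seq (.load ht (hg.cells hc).1 (.assign ?_))
    refine ⟨γ, t, p, by simp [ht], by simp [hp], hg, ⟨α, hi'⟩, hC, decide (m ≠ .O),
      by simp [Expr.eval], ?_⟩
    simp [mem_marked₀, h0, hc]

theorem wp_setup {r : ℕ} (h : Pre γ₀ r σ) : Wp (setup r) (LoopInvWith γ₀ fun _ => True) σ := by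
  obtain ⟨hg, hc, hr, hreach⟩ := h
  refine .seq (.assign (.seq (.assign (wp_readMark ?_))))
  exact ⟨γ₀, r, 0, by simp [Expr.eval], by simp [Expr.eval], hg, ⟨[], .init hc hr hreach⟩, trivial⟩

theorem loopCond_eval_iff (hp : σ.store .p = .ptr p) {b : Bool} (hb : σ.store .tm = .bool b) :
    loopCond.eval σ.store = .bool true ↔ p ≠ 0 ∨ b = false := by
  simp [loopCond, Expr.eval, hp, hb]

theorem wp_loopBody {n : ℕ} (h : LoopInvWith γ₀ (fun γ => visits γ = n) σ)
    (he : loopCond.eval σ.store = .bool true) :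
    Wp loopBody (LoopInvWith γ₀ fun γ => visits γ < n) σ := by
  obtain ⟨γ, t, p, ht, hp, hg, hi, rfl, b, hb, hbt⟩ := h
  rw [loopCond_eval_iff hp hb] at he
  refine .seq (Wp.mono (P := InvWith γ₀ fun γ' _ _ => visits γ' < visits γ) ?_
    fun σ' => wp_readMark)
  cases b with
  | false => exact .ite_false (by simp [Expr.eval, hb]) (wp_push ht hp hg hi (by simpa using hbt))
  | true =>
    refine .ite_true (by simp [Expr.eval, hb]) ?_
    obtain ⟨α, hi'⟩ := hi
    have hp0 : p ≠ 0 := by simpa using he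
    -- A non-null `p` is on the stack, hence marked `L` or `R`; so the test for `R` really separates
    -- SWING from POP.
    obtain ⟨m, l, r, hc, hm⟩ := hi'.mem_stack.1 (hi'.p_mem.resolve_left hp0)
    have htm : t ∈ marked₀ γ := hbt.1 rfl
    refine .seq (.load hp (hg.cells hc).1 ?_)
    rcases hm with rfl | rfl
    · exact .ite_false (by simp [Expr.eval]) (wp_swing (by simpa using ht) (by simpa using hp) hg
        ⟨α, hi'⟩ htm (val_eq_some.2 ⟨l, r, hc⟩))
    · exact .ite_true (by simp [Expr.eval]) (wp_pop (by simpa using ht) (by simpa using hp) hg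
        ⟨α, hi'⟩ htm (val_eq_some.2 ⟨l, r, hc⟩))

theorem LoopInv.exists_loopInvWith (h : LoopInv γ₀ σ) :
    ∃ n, LoopInvWith γ₀ (fun γ => visits γ = n) σ := by
  obtain ⟨γ, t, p, ht, hp, hg, hi, hC⟩ := h
  exact ⟨visits γ, γ, t, p, ht, hp, hg, hi, rfl, hC⟩

theorem LoopInv.post (h : LoopInv γ₀ σ) (he : loopCond.eval σ.store ≠ .bool true) :
    Post γ₀ σ := by
  obtain ⟨γ, t, p, ht, hp, hg, ⟨α, hi⟩, b, hb, hbt⟩ := h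
  rw [Ne, loopCond_eval_iff hp hb, not_or, not_not, Bool.not_eq_false] at he
  obtain ⟨rfl, rfl⟩ := he
  exact ⟨γ, hg, hi.final (hbt.1 rfl)⟩

theorem wp_schorrWaite {r : ℕ} (h : Pre γ₀ r σ) : Wp (schorrWaite r) (Post γ₀) σ := by
  refine .seq ((wp_setup h).mono fun σ' hσ' => ?_)
  obtain ⟨n, hn⟩ := hσ'.loopInv.exists_loopInvWith
  -- The index is the exact value of `visits`, so the strict bound from the body supplies the
  -- smaller index.
  refine (Wp.while (I := fun n => LoopInvWith γ₀ fun γ => visits γ = n) (fun n τ hτ he => ?_)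
    n σ' hn).mono fun τ hτ => ?_
  · refine (wp_loopBody hτ he).mono fun τ' hτ' => ?_
    obtain ⟨γ, t, p, ht, hp, hg, hi, hlt, hC⟩ := hτ'
    exact ⟨visits γ, hlt, γ, t, p, ht, hp, hg, hi, rfl, hC⟩
  · obtain ⟨⟨k, hk⟩, he⟩ := hτ
    exact hk.loopInv.post he

end SchorrWaite

theorem mainTheorem2 (γ₀ : BinaryGraph Mark) (r : ℕ) :
    -- total correctness of the algorithm on graphs connected from the root
    Triple (Pre γ₀ r) (schorrWaite r) (Post γ₀) ∧
    -- the loop invariant holds on entry to the loop and is preserved by the loop body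
    Triple (Pre γ₀ r) (setup r) (LoopInv γ₀) ∧
    Triple (fun σ => LoopInv γ₀ σ ∧ loopCond.eval σ.store = .bool true) loopBody (LoopInv γ₀) ∧
    -- the invariant is preserved by the three main operations
    Triple (InvWith γ₀ fun γ t _ => t ∉ marked₀ γ) push (InvWith γ₀ fun _ _ _ => True) ∧
    Triple (InvWith γ₀ fun γ t p => t ∈ marked₀ γ ∧ γ.val p = some .L) swing
      (InvWith γ₀ fun _ _ _ => True) ∧
    Triple (InvWith γ₀ fun γ t p => t ∈ marked₀ γ ∧ γ.val p = some .R) pop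
      (InvWith γ₀ fun _ _ _ => True) := by
  simp only [triple_iff_wp]
  refine ⟨fun σ => wp_schorrWaite, fun σ h => (wp_setup h).mono fun _ => LoopInvWith.loopInv,
    ?_, ?_, ?_, ?_⟩
  · rintro σ ⟨h, he⟩
    obtain ⟨n, hn⟩ := h.exists_loopInvWith
    exact (wp_loopBody hn he).mono fun _ => LoopInvWith.loopInv
  · rintro σ ⟨γ, t, p, ht, hp, hg, hi, htm⟩
    exact (wp_push ht hp hg hi htm).mono fun _ h => h.mono fun _ _ _ _ => trivial
  · rintro σ ⟨γ, t, p, ht, hp, hg, hi, htm, hv⟩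
    exact (wp_swing ht hp hg hi htm hv).mono fun _ h => h.mono fun _ _ _ _ => trivial
  · rintro σ ⟨γ, t, p, ht, hp, hg, hi, htm, hv⟩
    exact (wp_pop ht hp hg hi htm hv).mono fun _ h => h.mono fun _ _ _ _ => trivial
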